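/- Let $k\ge 1$ be an integer. Erdélyi's $k$-variable Laguerre polynomials $L^{(\alpha)}_{n_1,\dots,n_k}(\mathbf{x})$, $n_1,\dots,n_k\in\mathbb{Z}_{\ge 0}$, $\mathbf{x}=(x_1,\dots,x_k)$, are defined by the generating function $$(1-z_1-\cdots-z_k)^{-\alpha-1}\exp\left(-\frac{x_1z_1+\cdots+x_kz_k}{1-z_1-\cdots-z_k}\right)=\sum_{n_1,\dots,n_k=0}^{\infty}L^{(\alpha)}_{n_1,\dots,n_k}(\mathbf{x})\,z_1^{n_1}\cdots z_k^{n_k}.$$ Write $(a)_m=a(a+1)\cdots(a+m-1)$, with $(a)_0=1$, and $\|\mathbf{x}\|=\max_{1\le j\le k}|x_j|$. Let $\alpha>0$ and $x_j\ge 0$ for $j=1,\dots,k$. Then for all integers $n_1,\dots,n_k\ge 0$, $$\left|L^{(\alpha)}_{n_1,\dots,n_k}(\mathbf{x})\right|\le 2^{k-1}\,\frac{(\alpha+1)_{n_1+\cdots+n_k}}{(1/k)_{n_1}\cdots(1/k)_{n_k}}\;e^{\|\mathbf{x}\|/2}.$$ (For $k=1$, since $(1)_n=n!$, this reads $|L_n^{(\alpha)}(x)|\le\frac{(\alpha+1)_n}{n!}e^{x/2}$,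 which is Szegő's inequality.) -/

import Mathlib

/-!
Erdelyi's Laguerre polynomials in several variables, defined as the coefficients of their
generating function, read as a formal power series in the variables `z i`.
-/

namespace ErdelyiLaguerre

open MvPowerSeries

/-- The formal power series `(1 - ∑ i, z i) ^ (-α - 1)`: Newton's binomial series
`(1 + t) ^ (-α - 1)` at `t = -∑ i, z i`. -/
noncomputable def powerFactor {k : ℕ} (α : ℝ) : MvPowerSeries (Fin k) ℝ :=
  (PowerSeries.binomialSeries ℝ (-α - 1)).subst (-∑ i, (X i : MvPowerSeries (Fin k) ℝ))

/-- The formal power series `exp (-(∑ i, x i * z i) / (1 - ∑ i, z i))`. The inverse is a genuine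
one, because `1 - ∑ i, z i` has constant coefficient `1`. -/
noncomputable def expFactor {k : ℕ} (x : Fin k → ℝ) : MvPowerSeries (Fin k) ℝ :=
  (PowerSeries.exp ℝ).subst
    (-(∑ i, C (x i) * (X i : MvPowerSeries (Fin k) ℝ)) * (1 - ∑ i, X i)⁻¹)

/-- The generating function
`(1 - ∑ i, z i) ^ (-α - 1) * exp (-(∑ i, x i * z i) / (1 - ∑ i, z i))`. -/
noncomputable def generatingFunction {k : ℕ} (α : ℝ) (x : Fin k → ℝ) :
    MvPowerSeries (Fin k) ℝ :=
  powerFactor α * expFactor x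

/-- The multivariate Laguerre polynomial with parameter `α` and degrees `n i`, at the point `x`:
the coefficient of `∏ i, z i ^ n i` in the generating function. -/
noncomputable def laguerre {k : ℕ} (α : ℝ) (n : Fin k → ℕ) (x : Fin k → ℝ) : ℝ :=
  coeff (Finsupp.equivFunOnFinite.symm n) (generatingFunction α x)

/-- The Pochhammer symbol `(a)_m = a (a + 1) ⋯ (a + m - 1)`. -/
noncomputable def pochhammer (a : ℝ) (m : ℕ) : ℝ := (ascPochhammer ℝ m).eval a

end ErdelyiLaguerre

/-! ### One-variable Laguerre polynomials with small parameter -/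

namespace ErdelyiLaguerre

open Finset Nat

/-! The several-variable polynomial is an average of products of one-variable ones. Take `a j =
1/k`, which sum to `1`, and let `t` have the Dirichlet distribution with parameters `a 0, …, a (k -
1), α`. Comparing its moments with the explicit expansion of the generating function gives
`laguerre_eq_integral`: up to the quotient of Pochhammer symbols in the bound, the polynomial is the
mean of `∏ j, univLaguerre (1/k) (n j) (x j * t j)`. If each factor is at most `C * exp (x j * t j /
2)`, then `∑ j, t j ≤ 1` bounds the product by `C ^ k * exp (‖x‖ / 2)`.

It remains to have `C ^ k ≤ 2 ^ (k - 1)`. For `k ≥ 2`, `abs_univLaguerre_le` gives `C = 21/16`: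
halve the parameter, apply Cauchy–Schwarz to the convolution, and use that `exp (-y)` times a sum of
squares of Laguerre polynomials decreases in `y`. For `k = 1` the constant must be `1`;
`abs_univLaguerre_one_le` gets it by keeping one term of the Poisson norm of a Charlier polynomial.
-/

theorem pochhammer_zero (a : ℝ) : pochhammer a 0 = 1 := by simp [pochhammer]

theorem pochhammer_succ (a : ℝ) (n : ℕ) :
    pochhammer a (n + 1) = pochhammer a n * (a + n) := by
  simp [pochhammer, ascPochhammer_succ_eval]

theorem pochhammer_pos {a : ℝ} (ha : 0 < a) (n : ℕ) : 0 < pochhammer a n :=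
  ascPochhammer_pos n a ha

theorem pochhammer_add (a : ℝ) (m n : ℕ) :
    pochhammer a (m + n) = pochhammer a m * pochhammer (a + m) n := by
  induction n with
  | zero => simp [pochhammer_zero]
  | succ n ih =>
    rw [← add_assoc, pochhammer_succ, ih, pochhammer_succ]
    push_cast
    ring

/-- The coefficient `(a)_n / n!` of `w ^ n` in `(1 - w) ^ (-a)`. -/
noncomputable def risingCoeff (a : ℝ) (n : ℕ) : ℝ := pochhammer a n / n !

theorem risingCoeff_zero (a : ℝ) : risingCoeff a 0 = 1 := by
  simp [risingCoeff, pochhammer_zero]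

theorem risingCoeff_succ (a : ℝ) (n : ℕ) :
    risingCoeff a (n + 1) = risingCoeff a n * ((a + n) / (n + 1)) := by
  rw [risingCoeff, risingCoeff, pochhammer_succ, Nat.factorial_succ]
  push_cast
  field_simp

theorem risingCoeff_one (n : ℕ) : risingCoeff 1 n = 1 := by
  induction n with
  | zero => exact risingCoeff_zero 1
  | succ n ih => rw [risingCoeff_succ, ih]; field_simp; ring

theorem choose_neg_eq (a : ℝ) (n : ℕ) :
    Ring.choose (-a) n = (-1) ^ n * risingCoeff a n := by
  have h := Ring.factorial_nsmul_multichoose_eq_ascPochhammer a n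
  rw [Polynomial.ascPochhammer_smeval_eq_eval, nsmul_eq_mul] at h
  rw [Ring.choose_neg, ← Ring.multichoose_eq, Units.smul_def, zsmul_eq_mul,
    ← Int.cast_negOnePow_natCast, risingCoeff, pochhammer, ← h]
  field_simp

/-- Vandermonde's identity, from `(1 - w) ^ (-a) * (1 - w) ^ (-b) = (1 - w) ^ (-a - b)`. -/
theorem risingCoeff_add (a b : ℝ) (n : ℕ) :
    risingCoeff (a + b) n = ∑ p ∈ antidiagonal n, risingCoeff a p.1 * risingCoeff b p.2 := by
  have h := Ring.add_choose_eq (r := -a) (s := -b) n (Commute.all _ _)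
  rw [← neg_add, choose_neg_eq] at h
  have h1 : ((-1 : ℝ) ^ n) * (-1) ^ n = 1 := by rw [← mul_pow]; simp
  rw [← one_mul (risingCoeff _ _), ← h1, mul_assoc, h, mul_sum]
  refine sum_congr rfl fun p hp => ?_
  rw [choose_neg_eq, choose_neg_eq]
  have hn : (-1 : ℝ) ^ n = (-1) ^ p.1 * (-1) ^ p.2 := by
    rw [← pow_add, mem_antidiagonal.1 hp]
  calc _ = ((-1) ^ n * ((-1) ^ p.1 * (-1) ^ p.2)) * (risingCoeff a p.1 * risingCoeff b p.2) := by
        ring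
    _ = _ := by rw [← hn, h1, one_mul]

/-- The Laguerre polynomial `L_n ^ (a - 1)` of one variable. -/
noncomputable def univLaguerre (a : ℝ) (n : ℕ) (y : ℝ) : ℝ :=
  ∑ p ∈ antidiagonal n, (-y) ^ p.1 / p.1 ! * risingCoeff (a + p.1) p.2

/-- The generating function in `w` is `(1 - w) ^ (-a) * exp (-y w / (1 - w))`; raising `a` by `b`
multiplies it by `(1 - w) ^ (-b)`. -/
theorem univLaguerre_add (a b : ℝ) (n : ℕ) (y : ℝ) :
    univLaguerre (a + b) n y =
      ∑ p ∈ antidiagonal n, univLaguerre a p.1 y * risingCoeff b p.2 := by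
  simp only [univLaguerre, sum_mul]
  rw [Finset.sum_sigma']
  have h : ∀ p : ℕ × ℕ, (-y) ^ p.1 / p.1 ! * risingCoeff (a + b + p.1) p.2 =
      ∑ q ∈ antidiagonal p.2, (-y) ^ p.1 / p.1 ! * risingCoeff (a + p.1) q.1 *
        risingCoeff b q.2 := by
    intro p
    rw [show a + b + p.1 = a + p.1 + b by ring, risingCoeff_add, mul_sum]
    exact sum_congr rfl fun q _ => by ring
  simp only [h]
  rw [Finset.sum_sigma']
  exact (Finset.sum_nbij' (fun s => ⟨(s.2.1, s.2.2 + s.1.2), (s.2.2, s.1.2)⟩)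
    (fun s => ⟨(s.1.1 + s.2.1, s.2.2), (s.1.1, s.2.1)⟩)
    (by rintro ⟨⟨i, j⟩, ⟨k, l⟩⟩; simp; lia) (by rintro ⟨⟨i, j⟩, ⟨k, l⟩⟩; simp; lia)
    (by rintro ⟨⟨i, j⟩, ⟨k, l⟩⟩; simp) (by rintro ⟨⟨i, j⟩, ⟨k, l⟩⟩; simp)
    (by rintro ⟨⟨i, j⟩, ⟨k, l⟩⟩; simp)).symm

theorem univLaguerre_apply_zero (a : ℝ) (n : ℕ) : univLaguerre a n 0 = risingCoeff a n := by
  rw [univLaguerre, Finset.Nat.sum_antidiagonal_eq_sum_range_succ_mk, sum_range_succ']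
  simp

/-- Differentiating the generating function in `y` multiplies it by `-w / (1 - w)`. -/
theorem hasDerivAt_univLaguerre (a : ℝ) (n : ℕ) (y : ℝ) :
    HasDerivAt (univLaguerre a n) (-∑ i ∈ range n, univLaguerre a i y) y := by
  cases n with
  | zero =>
    have : univLaguerre a 0 = fun _ => 1 := by
      funext y; simp [univLaguerre, risingCoeff_zero]
    rw [this]
    simpa using hasDerivAt_const y (1 : ℝ)
  | succ n =>
    have h1 : ∑ i ∈ range (n + 1), univLaguerre a i y = univLaguerre (a + 1) n y := by
      rw [univLaguerre_add, Finset.Nat.sum_antidiagonal_eq_sum_range_succ_mk]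
      simp [risingCoeff_one]
    rw [h1]
    have h2 : univLaguerre a (n + 1) = fun y => risingCoeff a (n + 1) +
        ∑ p ∈ antidiagonal n, (-y) ^ (p.1 + 1) / (p.1 + 1)! * risingCoeff (a + (p.1 + 1)) p.2 := by
      funext y
      rw [univLaguerre, Finset.Nat.sum_antidiagonal_succ]
      simp
    rw [h2, univLaguerre, ← sum_neg_distrib]
    refine (HasDerivAt.fun_sum fun p _ => ?_).const_add _
    have h3 := (((hasDerivAt_neg y).pow (p.1 + 1)).div_const ((p.1 + 1)! : ℝ)).mul_const
      (risingCoeff (a + (p.1 + 1)) p.2)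
    refine h3.congr_deriv ?_
    rw [Nat.factorial_succ, show a + 1 + (p.1 : ℝ) = a + (p.1 + 1) by ring]
    push_cast
    field_simp

theorem two_mul_sum_range_mul_sum_range (f : ℕ → ℝ) (n : ℕ) :
    ∑ j ∈ range n, (f j ^ 2 + 2 * f j * ∑ i ∈ range j, f i) = (∑ j ∈ range n, f j) ^ 2 := by
  induction n with
  | zero => simp
  | succ n ih => rw [sum_range_succ, ih, sum_range_succ]; ring

theorem sum_sq_univLaguerre_le (a : ℝ) (n : ℕ) {y : ℝ} (hy : 0 ≤ y) :
    ∑ j ∈ range n, univLaguerre a j y ^ 2 ≤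
      Real.exp y * ∑ j ∈ range n, risingCoeff a j ^ 2 := by
  -- The cross terms produced by the derivative combine with the squares coming from `exp (-y)` into
  -- minus one perfect square.
  have hd : ∀ y, HasDerivAt
      (fun y => Real.exp (-y) * ∑ j ∈ range n, univLaguerre a j y ^ 2)
      (-(Real.exp (-y) * (∑ j ∈ range n, univLaguerre a j y) ^ 2)) y := by
    intro y
    have h1 := (hasDerivAt_neg y).exp.mul
      (HasDerivAt.fun_sum (u := range n) fun j _ => (hasDerivAt_univLaguerre a j y).pow 2)
    refine h1.congr_deriv ?_
    rw [← two_mul_sum_range_mul_sum_range, sum_add_distrib]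
    have h2 : ∑ j ∈ range n, ((2 : ℕ) : ℝ) * univLaguerre a j y ^ (2 - 1) *
        (-∑ i ∈ range j, univLaguerre a i y) =
        -∑ j ∈ range n, 2 * univLaguerre a j y * ∑ i ∈ range j, univLaguerre a i y := by
      rw [← sum_neg_distrib]
      exact sum_congr rfl fun j _ => by norm_num
    simp only [Pi.pow_apply] at *
    rw [h2]
    ring
  have hanti : Antitone (fun y => Real.exp (-y) * ∑ j ∈ range n, univLaguerre a j y ^ 2) :=
    antitone_of_hasDerivAt_nonpos hd fun y => neg_nonpos.2 (by positivity)
  have h := hanti hy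
  simp only [neg_zero, Real.exp_zero, one_mul, univLaguerre_apply_zero] at h
  calc _ = Real.exp y * (Real.exp (-y) * ∑ j ∈ range n, univLaguerre a j y ^ 2) := by
        rw [← mul_assoc, ← Real.exp_add]; simp
    _ ≤ _ := by gcongr

theorem sum_sq_risingCoeff_le {b : ℝ} (hb : 0 < b) (hb' : b ≤ 1 / 4) (n : ℕ) :
    ∑ j ∈ range n, risingCoeff b j ^ 2 ≤ 21 / 16 := by
  -- The extra term dominates the remaining tail: for `b ≤ 1/4` the squares decay at least like `j ^
  -- (-3/2)`, whose tail is about `2 j` times the last term. The initial value is `1 + b ^ 2 + 4 b ^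
  -- 2`, at most `21/16`.
  have key : ∀ n : ℕ, ∑ j ∈ range (n + 2), risingCoeff b j ^ 2 +
      2 * (n + 2) * risingCoeff b (n + 1) ^ 2 ≤ 1 + 5 * b ^ 2 := by
    intro n
    induction n with
    | zero =>
      simp only [sum_range_succ, range_zero, sum_empty, risingCoeff_zero, risingCoeff_succ]
      norm_num
      nlinarith
    | succ n ih =>
      rw [sum_range_succ]
      refine le_trans ?_ ih
      rw [risingCoeff_succ b (n + 1)]
      push_cast
      have hn : (0 : ℝ) ≤ n := n.cast_nonneg
      have h1 : (2 * (n + 1 + 2) + 1) * ((b + (n + 1)) / (n + 1 + 1)) ^ 2 ≤ 2 * ((n : ℝ) + 2) := by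
        rw [div_pow, ← mul_div_assoc, div_le_iff₀ (by positivity)]
        have h2 : (b + (n + 1)) ^ 2 ≤ (1 / 4 + ((n : ℝ) + 1)) ^ 2 := by gcongr
        nlinarith
      nlinarith [mul_le_mul_of_nonneg_right h1 (sq_nonneg (risingCoeff b (n + 1)))]
  calc _ ≤ ∑ j ∈ range (n + 2), risingCoeff b j ^ 2 :=
        sum_le_sum_of_subset_of_nonneg (range_mono (by lia)) fun _ _ _ => sq_nonneg _
    _ ≤ 1 + 5 * b ^ 2 := by
        have := key n
        have : 0 ≤ 2 * ((n : ℝ) + 2) * risingCoeff b (n + 1) ^ 2 := by positivity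
        linarith
    _ ≤ _ := by nlinarith

theorem abs_univLaguerre_le {a : ℝ} (ha : 0 < a) (ha' : a ≤ 1 / 2) (n : ℕ) {y : ℝ}
    (hy : 0 ≤ y) : |univLaguerre a n y| ≤ 21 / 16 * Real.exp (y / 2) := by
  have hb : 0 < a / 2 := by linarith
  have hb' : a / 2 ≤ 1 / 4 := by linarith
  have hs := sum_sq_risingCoeff_le hb hb' (n + 1)
  have hc := sum_mul_sq_le_sq_mul_sq (antidiagonal n)
    (fun p => univLaguerre (a / 2) p.1 y) (fun p => risingCoeff (a / 2) p.2)
  rw [← univLaguerre_add, add_halves] at hc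
  have h1 : ∑ p ∈ antidiagonal n, univLaguerre (a / 2) p.1 y ^ 2 =
      ∑ j ∈ range (n + 1), univLaguerre (a / 2) j y ^ 2 :=
    Finset.Nat.sum_antidiagonal_eq_sum_range_succ_mk _ n
  have h2 : ∑ p ∈ antidiagonal n, risingCoeff (a / 2) p.2 ^ 2 =
      ∑ j ∈ range (n + 1), risingCoeff (a / 2) j ^ 2 := by
    rw [← Finset.Nat.sum_antidiagonal_swap]
    exact Finset.Nat.sum_antidiagonal_eq_sum_range_succ_mk _ n
  rw [h1, h2] at hc
  refine abs_le_of_sq_le_sq (hc.trans ?_) (by positivity)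
  calc _ ≤ (Real.exp y * (21 / 16)) * (21 / 16) := by
        refine mul_le_mul ((sum_sq_univLaguerre_le _ _ hy).trans ?_) hs
          (sum_nonneg fun _ _ => sq_nonneg _) (by positivity)
        gcongr
    _ = _ := by
        rw [mul_pow, ← Real.exp_nat_mul, show ((2 : ℕ) : ℝ) * (y / 2) = y by push_cast; ring]
        ring

end ErdelyiLaguerre

/-! ### Charlier polynomials and the parameter-one bound -/

namespace ErdelyiLaguerre

open Finset Nat

/-- The monic Charlier polynomials, orthogonal for the Poisson distribution of mean `x`. -/
noncomputable def charlier (x : ℝ) : ℕ → ℕ → ℝ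
  | 0, _ => 1
  | n + 1, m => m * charlier x n (m - 1) - x * charlier x n m

theorem charlier_succ_zero (x : ℝ) (n : ℕ) :
    charlier x (n + 1) 0 = -x * charlier x n 0 := by
  simp [charlier]

theorem charlier_succ_succ (x : ℝ) (n m : ℕ) :
    charlier x (n + 1) (m + 1) = (m + 1) * charlier x n m - x * charlier x n (m + 1) := by
  simp [charlier]

theorem charlier_forward_diff (x : ℝ) (n m : ℕ) :
    charlier x n (m + 1) - charlier x n m = n * charlier x (n - 1) m := by
  induction n generalizing m with
  | zero => simp [charlier]
  | succ n ih =>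
    have h1 := ih m
    cases m with
    | zero =>
      rw [charlier_succ_succ, charlier_succ_zero]
      cases n with
      | zero => simp [charlier]
      | succ n =>
        simp only [Nat.add_sub_cancel, charlier_succ_zero, charlier_succ_succ] at *
        push_cast at *
        linear_combination (-x) * h1
    | succ m =>
      have h2 := ih m
      rw [charlier_succ_succ, charlier_succ_succ]
      cases n with
      | zero => simp [charlier]
      | succ n =>
        simp only [Nat.add_sub_cancel] at *
        have h3 := charlier_succ_succ x n m
        push_cast at *
        linear_combination (-x) * h1 + (m + 1) * h2 - (n + 1) * h3

theorem abs_charlier_le {x : ℝ} (hx : 0 ≤ x) (n m : ℕ) : |charlier x n m| ≤ (m + x) ^ n := by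
  induction n generalizing m with
  | zero => simp [charlier]
  | succ n ih =>
    rw [charlier]
    have h1 : |charlier x n (m - 1)| ≤ (m + x) ^ n := by
      refine (ih (m - 1)).trans ?_
      have : ((m - 1 : ℕ) : ℝ) ≤ m := by exact_mod_cast Nat.sub_le m 1
      gcongr
    calc _ ≤ |m * charlier x n (m - 1)| + |x * charlier x n m| := abs_sub _ _
      _ = m * |charlier x n (m - 1)| + x * |charlier x n m| := by
        rw [abs_mul, abs_mul, abs_of_nonneg hx, Nat.abs_cast]
      _ ≤ m * (m + x) ^ n + x * (m + x) ^ n := by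
        gcongr
        exact ih m
      _ = _ := by ring

theorem summable_charlier_mul {x : ℝ} (hx : 0 ≤ x) (n n' : ℕ) :
    Summable fun m : ℕ => charlier x n m * charlier x n' m * (x ^ m / m !) := by
  -- With `N = n + n'`, `(m + x) ^ N ≤ N! * exp (m + x)`, and `exp m` is absorbed into `x ^ m`.
  have hs := (Real.summable_pow_div_factorial (Real.exp 1 * x)).mul_left
    ((n + n')! * Real.exp x)
  refine Summable.of_norm_bounded hs fun m => ?_
  have h1 : ((m : ℝ) + x) ^ (n + n') ≤ (n + n')! * Real.exp (m + x) := by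
    have := Real.pow_div_factorial_le_exp (m + x) (by positivity) (n + n')
    rwa [div_le_iff₀' (by positivity)] at this
  rw [Real.norm_eq_abs, abs_mul, abs_mul, abs_of_nonneg (a := x ^ m / m !) (by positivity)]
  calc _ ≤ (m + x) ^ n * (m + x) ^ n' * (x ^ m / m !) := by
        gcongr <;> exact abs_charlier_le hx _ _
    _ ≤ ((n + n')! * Real.exp (m + x)) * (x ^ m / m !) := by
        rw [← pow_add]
        gcongr
    _ = _ := by
        rw [Real.exp_add, mul_pow, ← Real.exp_nat_mul, mul_one]
        ring

/-- Expand one factor by the recurrence and shift `m` in the part carrying `m`. The forward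
difference then makes the mixed sums cancel, leaving `(n + 1) * x` times the previous norm;
orthogonality is not needed. -/
theorem tsum_charlier_sq {x : ℝ} (hx : 0 ≤ x) (n : ℕ) :
    ∑' m : ℕ, charlier x n m ^ 2 * (x ^ m / m !) = n ! * x ^ n * Real.exp x := by
  induction n with
  | zero =>
    simp [charlier, Real.exp_eq_exp_ℝ, NormedSpace.exp_eq_tsum_div]
  | succ n ih =>
    have hs := summable_charlier_mul hx (n + 1) (n + 1)
    have hs' := summable_charlier_mul hx n (n + 1)
    have hs'' := summable_charlier_mul hx n n
    set A : ℕ → ℝ := fun m => m * charlier x n (m - 1) * charlier x (n + 1) m * (x ^ m / m !)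
      with hA
    have hsA : Summable A := by
      refine (hs.add (hs'.mul_left x)).congr fun m => ?_
      rw [hA]
      have : charlier x (n + 1) m = m * charlier x n (m - 1) - x * charlier x n m := rfl
      simp only
      generalize charlier x (n + 1) m = c at this ⊢
      rw [this]
      ring
    have hsplit : ∀ m, charlier x (n + 1) m ^ 2 * (x ^ m / m !) =
        A m - x * (charlier x n m * charlier x (n + 1) m * (x ^ m / m !)) := by
      intro m
      have : charlier x (n + 1) m = m * charlier x n (m - 1) - x * charlier x n m := rfl
      rw [hA]
      simp only
      generalize charlier x (n + 1) m = c at this ⊢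
      rw [this]
      ring
    have hA' : ∀ m, A (m + 1) = x * (charlier x n m * charlier x (n + 1) m * (x ^ m / m !)) +
        (n + 1) * x * (charlier x n m ^ 2 * (x ^ m / m !)) := by
      intro m
      have h := charlier_forward_diff x (n + 1) m
      have h' : charlier x (n + 1) (m + 1) = charlier x (n + 1) m + (n + 1) * charlier x n m := by
        simp only [Nat.add_sub_cancel] at h
        push_cast at h
        linarith
      rw [hA]
      simp only [Nat.add_sub_cancel]
      rw [h', Nat.factorial_succ]
      push_cast
      field_simp
      ring
    have hA0 : A 0 = 0 := by simp [hA]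
    simp only [hsplit]
    rw [hsA.tsum_sub (hs'.mul_left x), hsA.tsum_eq_zero_add, hA0, zero_add]
    simp only [hA']
    have hs2 : Summable fun m : ℕ => charlier x n m ^ 2 * (x ^ m / m !) := by
      simpa only [sq] using hs''
    rw [(hs'.mul_left x).tsum_add (hs2.mul_left _), add_sub_cancel_left, tsum_mul_left, ih,
      Nat.factorial_succ]
    push_cast
    ring

theorem charlier_eq_sum (x : ℝ) (n m : ℕ) :
    charlier x n m =
      ∑ i ∈ range (n + 1), (n.choose i : ℝ) * (-x) ^ i * (m.descFactorial (n - i) : ℝ) := by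
  induction n generalizing m with
  | zero => simp [charlier]
  | succ n ih =>
    have h1 : (m : ℝ) * charlier x n (m - 1) = ∑ i ∈ range (n + 1),
        (n.choose i : ℝ) * (-x) ^ i * (m.descFactorial (n + 1 - i) : ℝ) := by
      rw [ih, mul_sum]
      refine sum_congr rfl fun i hi => ?_
      have hi' : n + 1 - i = (n - i) + 1 := by have := mem_range.1 hi; lia
      rw [hi']
      cases m with
      | zero => simp
      | succ m => rw [Nat.succ_descFactorial_succ, Nat.add_sub_cancel]; push_cast; ring
    rw [charlier, h1, ih, mul_sum, sum_range_succ' _ (n + 1)]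
    rw [sum_range_succ' _ n]
    have h2 : ∑ i ∈ range (n + 1), ((n + 1).choose (i + 1) : ℝ) * (-x) ^ (i + 1) *
        (m.descFactorial (n + 1 - (i + 1)) : ℝ) =
        ∑ i ∈ range (n + 1), (n.choose (i + 1) : ℝ) * (-x) ^ (i + 1) *
          (m.descFactorial (n + 1 - (i + 1)) : ℝ) -
        ∑ i ∈ range (n + 1), x * ((n.choose i : ℝ) * (-x) ^ i *
          (m.descFactorial (n - i) : ℝ)) := by
      rw [← sum_sub_distrib]
      refine sum_congr rfl fun i _ => ?_
      rw [Nat.choose_succ_succ, Nat.add_sub_add_right]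
      push_cast
      ring
    rw [h2, sum_range_succ (fun i => (n.choose (i + 1) : ℝ) * _ * _) n]
    simp
    ring

theorem charlier_self (x : ℝ) (n : ℕ) : charlier x n n = n ! * univLaguerre 1 n x := by
  rw [charlier_eq_sum, univLaguerre, Finset.Nat.sum_antidiagonal_eq_sum_range_succ_mk, mul_sum]
  refine sum_congr rfl fun i hi => ?_
  have hi' : i ≤ n := by have := mem_range.1 hi; lia
  have h1 : (n.descFactorial (n - i) : ℝ) * i ! = n ! := by
    have := Nat.factorial_mul_descFactorial (Nat.sub_le n i)
    rw [Nat.sub_sub_self hi'] at this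
    rw [mul_comm]
    exact_mod_cast this
  have h2 : ((n.choose i : ℝ)) = risingCoeff (1 + i) (n - i) := by
    have h3 : ∀ l : ℕ, pochhammer 1 l = l ! := fun l => by
      have := risingCoeff_one l
      rwa [risingCoeff, div_eq_one_iff_eq (by positivity)] at this
    have h4 := pochhammer_add 1 i (n - i)
    rw [Nat.add_sub_cancel' hi', h3, h3] at h4
    rw [risingCoeff, Nat.cast_choose ℝ hi', h4]
    field_simp
  simp only
  rw [← h1, ← h2]
  field_simp

theorem abs_univLaguerre_one_le (n : ℕ) {y : ℝ} (hy : 0 ≤ y) :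
    |univLaguerre 1 n y| ≤ Real.exp (y / 2) := by
  -- The main argument cancels `y ^ n`, so `y = 0` is separate.
  rcases hy.eq_or_lt with rfl | hy'
  · simp [univLaguerre_apply_zero, risingCoeff_one]
  have hs : Summable fun m : ℕ => charlier y n m ^ 2 * (y ^ m / m !) := by
    simpa only [sq] using summable_charlier_mul hy n n
  -- Only the term `m = n` is kept, where the Charlier polynomial is `n!` times the Laguerre one.
  have h := hs.le_tsum n fun m _ => by positivity
  rw [tsum_charlier_sq hy, charlier_self] at h
  have h2 : (n ! * y ^ n) * univLaguerre 1 n y ^ 2 ≤ (n ! * y ^ n) * Real.exp y := by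
    refine le_trans (le_of_eq ?_) h
    field_simp
  refine abs_le_of_sq_le_sq ?_ (Real.exp_pos _).le
  rw [← Real.exp_nat_mul, show ((2 : ℕ) : ℝ) * (y / 2) = y by push_cast; ring]
  exact le_of_mul_le_mul_left h2 (by positivity)

end ErdelyiLaguerre

/-! ### Beta and Dirichlet moments -/

namespace ErdelyiLaguerre

open Finset Nat MeasureTheory ProbabilityTheory

theorem Gamma_add_nat {a : ℝ} (ha : 0 < a) (n : ℕ) :
    Real.Gamma (a + n) = Real.Gamma a * pochhammer a n := by
  induction n with
  | zero => simp [pochhammer_zero]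
  | succ n ih =>
    push_cast
    rw [← add_assoc, Real.Gamma_add_one (by positivity), ih, pochhammer_succ]
    ring

theorem ae_betaMeasure_mem_Ioo (a b : ℝ) : ∀ᵐ s ∂betaMeasure a b, s ∈ Set.Ioo (0 : ℝ) 1 := by
  rw [betaMeasure, ae_withDensity_iff (by unfold betaPDF; fun_prop)]
  refine Filter.Eventually.of_forall fun s hs => ?_
  by_contra h
  exact hs (by rw [betaPDF_eq, if_neg (show ¬(0 < s ∧ s < 1) from h), ENNReal.ofReal_zero])

theorem integral_betaPDFReal {a b : ℝ} (ha : 0 < a) (hb : 0 < b) :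
    ∫ s, betaPDFReal a b s = 1 := by
  rw [integral_eq_lintegral_of_nonneg_ae]
  · exact (congrArg ENNReal.toReal (lintegral_betaPDF_eq_one ha hb)).trans ENNReal.toReal_one
  · refine Filter.Eventually.of_forall fun s => ?_
    by_cases hs : 0 < s ∧ s < 1
    · exact (betaPDFReal_pos hs.1 hs.2 ha hb).le
    · simp [betaPDFReal, hs]
  · fun_prop

theorem integral_betaMeasure {a b : ℝ} (ha : 0 < a) (hb : 0 < b) (m l : ℕ) :
    ∫ s, s ^ m * (1 - s) ^ l ∂betaMeasure a b =
      pochhammer a m * pochhammer b l / pochhammer (a + b) (m + l) := by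
  have h0 : ∀ s, (betaPDF a b s).toReal = betaPDFReal a b s := by
    intro s
    refine ENNReal.toReal_ofReal ?_
    by_cases hs : 0 < s ∧ s < 1
    · exact (betaPDFReal_pos hs.1 hs.2 ha hb).le
    · simp [betaPDFReal, hs]
  rw [betaMeasure, integral_withDensity_eq_integral_toReal_smul (by unfold betaPDF; fun_prop)
    (Filter.Eventually.of_forall fun s => by simp [betaPDF])]
  have ha' : 0 < a + m := by positivity
  have hb' : 0 < b + l := by positivity
  have hpt : ∀ s, (betaPDF a b s).toReal • (s ^ m * (1 - s) ^ l) =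
      (ProbabilityTheory.beta (a + m) (b + l) / ProbabilityTheory.beta a b) * betaPDFReal (a + m) (b + l) s := by
    intro s
    rw [h0, betaPDFReal, betaPDFReal]
    split_ifs with hs
    · have h1 : 0 < 1 - s := by linarith [hs.2]
      rw [show a + m - 1 = (a - 1) + m by ring, show b + l - 1 = (b - 1) + l by ring,
        Real.rpow_add_natCast hs.1.ne', Real.rpow_add_natCast h1.ne', smul_eq_mul]
      have := (beta_pos ha' hb').ne'
      have := (beta_pos ha hb).ne'
      field_simp
    · simp
  simp only [hpt]
  rw [integral_const_mul, integral_betaPDFReal ha' hb', mul_one, ProbabilityTheory.beta,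
    ProbabilityTheory.beta,
    show a + m + (b + l) = a + b + (m + l : ℕ) by push_cast; ring,
    Gamma_add_nat ha, Gamma_add_nat hb, Gamma_add_nat (add_pos ha hb)]
  have := (Real.Gamma_pos_of_pos ha).ne'
  have := (Real.Gamma_pos_of_pos hb).ne'
  have := (Real.Gamma_pos_of_pos (add_pos ha hb)).ne'
  have := (pochhammer_pos (add_pos ha hb) (m + l)).ne'
  field_simp

/-- Existence of the Dirichlet distribution with parameters `a 0, …, a (k - 1), b`, described by
its moments. -/
theorem exists_dirichlet {b : ℝ} (hb : 0 < b) (k : ℕ) (a : Fin k → ℝ) (ha : ∀ j, 0 < a j) :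
    ∃ μ : Measure (Fin k → ℝ), IsProbabilityMeasure μ ∧
      (∀ᵐ t ∂μ, (∀ j, 0 ≤ t j) ∧ ∑ j, t j ≤ 1) ∧
      ∀ m : Fin k → ℕ, ∫ t, ∏ j, t j ^ m j ∂μ =
        (∏ j, pochhammer (a j) (m j)) / pochhammer (∑ j, a j + b) (∑ j, m j) := by
  induction k with
  | zero =>
    refine ⟨Measure.dirac 0, inferInstance, ?_, fun m => ?_⟩
    · exact Filter.Eventually.of_forall fun t => ⟨fun j => j.elim0, by simp⟩
    · simp [pochhammer_zero]
  | succ k ih =>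
    obtain ⟨μ, hμ, hsupp, hmom⟩ := ih (fun j => a j.succ) fun j => ha _
    set c : ℝ := ∑ j : Fin k, a j.succ + b with hc
    have hc0 : 0 < c := add_pos_of_nonneg_of_pos (sum_nonneg fun j _ => (ha _).le) hb
    have hβ : IsProbabilityMeasure (betaMeasure (a 0) c) := isProbabilityMeasureBeta (ha 0) hc0
    -- Stick breaking: a beta variable is the first coordinate, and an independent smaller Dirichlet
    -- vector is scaled to the remaining length.
    let F : ℝ × (Fin k → ℝ) → (Fin (k + 1) → ℝ) :=
      fun p => Fin.cons p.1 fun j => (1 - p.1) * p.2 j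
    have hF : Measurable F := by
      refine measurable_pi_lambda _ fun j => ?_
      refine Fin.cases ?_ (fun j => ?_) j
      · simpa [F] using measurable_fst
      · simp only [F, Fin.cons_succ]
        fun_prop
    refine ⟨((betaMeasure (a 0) c).prod μ).map F, Measure.isProbabilityMeasure_map hF.aemeasurable,
      ?_, fun m => ?_⟩
    · have hmeas : MeasurableSet {t : Fin (k + 1) → ℝ | (∀ j, 0 ≤ t j) ∧ ∑ j, t j ≤ 1} := by
        rw [Set.ofPred_and, Set.ofPred_forall]
        exact (MeasurableSet.iInter fun j => measurableSet_le (by fun_prop) (by fun_prop)).inter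
          (measurableSet_le (by fun_prop) (by fun_prop))
      rw [ae_map_iff hF.aemeasurable hmeas]
      filter_upwards [Measure.quasiMeasurePreserving_fst.ae (ae_betaMeasure_mem_Ioo (a 0) c),
        Measure.quasiMeasurePreserving_snd.ae hsupp] with p h1 h2
      have h3 : 0 ≤ 1 - p.1 := by linarith [h1.2]
      have h4 : ∀ j, 0 ≤ F p j := Fin.forall_fin_succ.2
        ⟨by simpa [F] using h1.1.le, fun j => by simpa [F] using mul_nonneg h3 (h2.1 j)⟩
      refine ⟨h4, ?_⟩
      simp only [F, Fin.sum_univ_succ, Fin.cons_zero, Fin.cons_succ, ← mul_sum]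
      nlinarith [mul_le_mul_of_nonneg_left h2.2 h3]
    · rw [integral_map hF.aemeasurable (by
        exact (Measurable.aestronglyMeasurable (by fun_prop)))]
      have hpt : ∀ p : ℝ × (Fin k → ℝ), ∏ j, F p j ^ m j =
          (p.1 ^ m 0 * (1 - p.1) ^ (∑ j : Fin k, m j.succ)) * ∏ j, p.2 j ^ m j.succ := by
        intro p
        simp only [F, Fin.prod_univ_succ, Fin.cons_zero, Fin.cons_succ, mul_pow, prod_mul_distrib,
          prod_pow_eq_pow_sum]
        ring
      simp only [hpt]
      rw [integral_prod_mul (fun s : ℝ => s ^ m 0 * (1 - s) ^ (∑ j : Fin k, m j.succ))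
        (fun t : Fin k → ℝ => ∏ j, t j ^ m j.succ), integral_betaMeasure (ha 0) hc0, hmom,
        Fin.prod_univ_succ, Fin.sum_univ_succ, Fin.sum_univ_succ, add_assoc, ← hc]
      have := (pochhammer_pos hc0 (∑ j : Fin k, m j.succ)).ne'
      field_simp

end ErdelyiLaguerre

/-! ### Coefficients of the generating function -/

namespace ErdelyiLaguerre

open Finset Nat MvPowerSeries

theorem coeff_sum_C_mul_X_pow {k : ℕ} (c : Fin k → ℝ) (q : ℕ) (e : Fin k →₀ ℕ) :
    coeff e ((∑ i, C (c i) * (X i : MvPowerSeries (Fin k) ℝ)) ^ q) =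
      if ∑ i, e i = q then q ! * ∏ i, (c i ^ e i / (e i)!) else 0 := by
  have hcoe : (∑ i, C (c i) * (X i : MvPowerSeries (Fin k) ℝ)) ^ q =
      (((∑ i, MvPolynomial.C (c i) * MvPolynomial.X i) ^ q : MvPolynomial (Fin k) ℝ) :
        MvPowerSeries (Fin k) ℝ) := by
    rw [MvPolynomial.coe_pow, ← MvPolynomial.coeToMvPowerSeries.ringHom_apply, map_sum]
    simp
  have hmon : ∀ p : Fin k → ℕ, ∏ i, (MvPolynomial.C (c i) * MvPolynomial.X i) ^ p i =
      MvPolynomial.monomial (Finsupp.equivFunOnFinite.symm p) (∏ i, c i ^ p i) := by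
    intro p
    rw [MvPolynomial.monomial_eq, Finsupp.prod_fintype _ _ (by simp)]
    simp [mul_pow, prod_mul_distrib]
  rw [hcoe, MvPolynomial.coeff_coe, sum_pow_eq_sum_piAntidiag, MvPolynomial.coeff_sum]
  have hterm : ∀ p ∈ piAntidiag univ q, MvPolynomial.coeff e
      ((Nat.multinomial univ p : MvPolynomial (Fin k) ℝ) *
        ∏ i, (MvPolynomial.C (c i) * MvPolynomial.X i) ^ p i) =
      if p = e then q ! * ∏ i, (c i ^ e i / (e i)!) else 0 := by
    intro p hp
    have hp' : ∑ i, p i = q := by simpa using hp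
    rw [hmon, ← map_natCast (MvPolynomial.C (σ := Fin k) (R := ℝ)), MvPolynomial.coeff_C_mul,
      MvPolynomial.coeff_monomial]
    have hiff : Finsupp.equivFunOnFinite.symm p = e ↔ p = e := by
      rw [Equiv.symm_apply_eq]; rfl
    simp only [hiff]
    split_ifs with h
    · have hm := Nat.multinomial_spec univ p
      rw [hp'] at hm
      rw [← hm, h, prod_div_distrib]
      push_cast
      have : ∏ i, ((e i)! : ℝ) ≠ 0 := prod_ne_zero_iff.2 fun i _ => by positivity
      field_simp
    · simp
  rw [sum_congr rfl hterm, sum_ite_eq']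
  simp

theorem coeff_pow_eq_zero {k : ℕ} {f : MvPowerSeries (Fin k) ℝ} (hf : constantCoeff f = 0)
    (e : Fin k →₀ ℕ) {d : ℕ} (hd : ∑ i, e i < d) : coeff e (f ^ d) = 0 := by
  refine coeff_of_lt_order (lt_of_lt_of_le ?_ (le_order_pow_of_constantCoeff_eq_zero d hf))
  rw [Finsupp.degree_eq_sum]
  exact_mod_cast hd

theorem coeff_subst_eq_sum {k : ℕ} {f : MvPowerSeries (Fin k) ℝ} (hf : constantCoeff f = 0)
    (g : PowerSeries ℝ) (e : Fin k →₀ ℕ) {M : ℕ} (hM : ∑ i, e i < M) :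
    coeff e (g.subst f) = ∑ d ∈ range M, PowerSeries.coeff d g * coeff e (f ^ d) := by
  rw [PowerSeries.coeff_subst (PowerSeries.HasSubst.of_constantCoeff_zero hf),
    finsum_eq_sum_of_support_subset _ (s := range M)]
  · simp
  · intro d hd
    by_contra h
    refine hd ?_
    have : M ≤ d := by simpa using h
    simp [coeff_pow_eq_zero hf e (hM.trans_le this)]

section

variable {k : ℕ}

theorem constantCoeff_neg_sum_X :
    constantCoeff (-∑ i, (X i : MvPowerSeries (Fin k) ℝ)) = 0 := by
  simp

theorem coeff_powerFactor (α : ℝ) (e : Fin k →₀ ℕ) :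
    coeff e (powerFactor (k := k) α) = pochhammer (α + 1) (∑ i, e i) / ∏ i, ((e i)! : ℝ) := by
  rw [powerFactor, coeff_subst_eq_sum constantCoeff_neg_sum_X _ e (Nat.lt_succ_self _)]
  have h : ∀ d, coeff e ((-∑ i, (X i : MvPowerSeries (Fin k) ℝ)) ^ d) =
      if ∑ i, e i = d then d ! * ((-1) ^ d / ∏ i, ((e i)! : ℝ)) else 0 := by
    intro d
    have h1 := coeff_sum_C_mul_X_pow (fun _ : Fin k => (-1 : ℝ)) d e
    have h2 : ∑ i : Fin k, C (-1 : ℝ) * (X i : MvPowerSeries (Fin k) ℝ) = -∑ i, X i := by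
      rw [← mul_sum]
      simp
    rw [h2] at h1
    rw [h1]
    split_ifs with hd
    · rw [prod_div_distrib, prod_pow_eq_pow_sum, hd]
    · rfl
  simp only [h, mul_ite, mul_zero, sum_ite_eq]
  rw [if_pos (by simp), PowerSeries.binomialSeries_coeff, show -α - 1 = -(α + 1) by ring,
    choose_neg_eq, risingCoeff]
  have h1 : ((-1 : ℝ) ^ (∑ i, e i)) * (-1) ^ (∑ i, e i) = 1 := by rw [← mul_pow]; simp
  simp only [smul_eq_mul, mul_one]
  calc _ = ((-1 : ℝ) ^ (∑ i, e i)) * (-1) ^ (∑ i, e i) *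
        (pochhammer (α + 1) (∑ i, e i) / ∏ i, ((e i)! : ℝ)) := by field_simp
    _ = _ := by rw [h1, one_mul]

theorem powerFactor_add_one_mul (α : ℝ) :
    powerFactor (k := k) (α + 1) * (1 - ∑ i, X i) = powerFactor α := by
  have hs := PowerSeries.HasSubst.of_constantCoeff_zero (constantCoeff_neg_sum_X (k := k))
  have h1 : (1 - ∑ i, (X i : MvPowerSeries (Fin k) ℝ)) =
      (PowerSeries.binomialSeries ℝ (1 : ℝ)).subst (-∑ i, (X i : MvPowerSeries (Fin k) ℝ)) := by
    have : PowerSeries.binomialSeries ℝ (1 : ℝ) = 1 + PowerSeries.X := by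
      simpa using PowerSeries.binomialSeries_nat (R := ℝ) (A := ℝ) 1
    rw [this, ← PowerSeries.coe_substAlgHom hs, map_add, map_one, PowerSeries.substAlgHom_X hs,
      sub_eq_add_neg]
  rw [h1, powerFactor, powerFactor, ← PowerSeries.subst_mul hs, ← PowerSeries.binomialSeries_add]
  congr 2
  ring

theorem powerFactor_mul_inv_pow (α : ℝ) (p : ℕ) :
    powerFactor (k := k) α * ((1 - ∑ i, X i)⁻¹) ^ p = powerFactor (α + p) := by
  induction p with
  | zero => simp
  | succ p ih =>
    have hinv : (1 - ∑ i, (X i : MvPowerSeries (Fin k) ℝ)) * (1 - ∑ i, X i)⁻¹ = 1 :=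
      MvPowerSeries.mul_inv_cancel _ (by simp)
    rw [pow_succ, ← mul_assoc, ih, ← powerFactor_add_one_mul, mul_assoc, hinv, mul_one]
    push_cast
    ring_nf

theorem laguerre_eq_sum (α : ℝ) (n : Fin k → ℕ) (x : Fin k → ℝ) :
    laguerre α n x = ∑ p ∈ antidiagonal (Finsupp.equivFunOnFinite.symm n),
      (∏ i, (-x i) ^ p.1 i / ((p.1 i)! * (p.2 i)!)) *
        pochhammer (α + 1 + ∑ i, p.1 i) (∑ i, p.2 i) := by
  set ν := Finsupp.equivFunOnFinite.symm n with hν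
  set M := ∑ i, ν i + 1 with hM
  set ξ : MvPowerSeries (Fin k) ℝ := ∑ i, C (-x i) * X i with hξ
  set G : MvPowerSeries (Fin k) ℝ := (1 - ∑ i, X i)⁻¹ with hG
  have harg : -(∑ i, C (x i) * (X i : MvPowerSeries (Fin k) ℝ)) * G = ξ * G := by
    rw [hξ]
    simp
  have hcc : constantCoeff (ξ * G) = 0 := by simp [hξ]
  have hdeg : ∀ p ∈ antidiagonal ν, ∑ i, p.1 i + ∑ i, p.2 i = ∑ i, ν i := by
    intro p hp
    rw [← mem_antidiagonal.1 hp, ← sum_add_distrib]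
    rfl
  -- Since `ξ * G` has no constant term, powers beyond the total degree of `ν` do not contribute, so
  -- the exponential may be truncated.
  have h1 : coeff ν (generatingFunction α x) = coeff ν (powerFactor α *
      ∑ d ∈ range M, C ((d ! : ℝ)⁻¹) * (ξ * G) ^ d) := by
    rw [generatingFunction, coeff_mul, coeff_mul]
    refine sum_congr rfl fun p hp => ?_
    have := hdeg p hp
    rw [expFactor, harg, coeff_subst_eq_sum hcc _ _ (M := M) (by lia), map_sum]
    congr 1
    refine sum_congr rfl fun d _ => ?_
    rw [coeff_C_mul, PowerSeries.coeff_exp]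
    simp
  have h2 : powerFactor α * ∑ d ∈ range M, C ((d ! : ℝ)⁻¹) * (ξ * G) ^ d =
      ∑ d ∈ range M, C ((d ! : ℝ)⁻¹) * (ξ ^ d * powerFactor (α + d)) := by
    rw [mul_sum]
    refine sum_congr rfl fun d _ => ?_
    rw [← powerFactor_mul_inv_pow, mul_pow]
    ring
  rw [laguerre, h1, h2, map_sum]
  simp only [coeff_C_mul]
  simp only [coeff_mul, mul_sum]
  rw [sum_comm]
  refine sum_congr rfl fun p hp => ?_
  have hp' := hdeg p hp
  rw [sum_eq_single (∑ i, p.1 i)]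
  · rw [hξ, coeff_sum_C_mul_X_pow, if_pos rfl, coeff_powerFactor]
    simp only [prod_div_distrib, prod_mul_distrib]
    push_cast
    rw [show α + ∑ i, (p.1 i : ℝ) + 1 = α + 1 + ∑ i, (p.1 i : ℝ) by ring]
    field_simp
  · intro d _ hd
    rw [hξ, coeff_sum_C_mul_X_pow, if_neg (Ne.symm hd)]
    simp
  · intro h
    exact absurd (mem_range.2 (by lia)) h

end

end ErdelyiLaguerre

/-! ### Dirichlet averaging and the final bound -/

namespace ErdelyiLaguerre

open Finset Nat MeasureTheory

theorem laguerre_eq_sum_piFinset {k : ℕ} (α : ℝ) (n : Fin k → ℕ) (x : Fin k → ℝ) :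
    laguerre α n x = ∑ q ∈ Fintype.piFinset fun j => antidiagonal (n j),
      (∏ j, (-x j) ^ (q j).1 / ((q j).1 ! * (q j).2 !)) *
        pochhammer (α + 1 + (∑ j, (q j).1 : ℕ)) (∑ j, (q j).2) := by
  rw [laguerre_eq_sum]
  refine sum_nbij' (fun p j => (p.1 j, p.2 j))
    (fun q => (Finsupp.equivFunOnFinite.symm fun j => (q j).1,
      Finsupp.equivFunOnFinite.symm fun j => (q j).2)) ?_ ?_ ?_ ?_ ?_
  · intro p hp
    refine Fintype.mem_piFinset.2 fun j => mem_antidiagonal.2 ?_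
    exact DFunLike.congr_fun (mem_antidiagonal.1 hp) j
  · intro q hq
    refine mem_antidiagonal.2 (Finsupp.ext fun j => ?_)
    exact mem_antidiagonal.1 (Fintype.mem_piFinset.1 hq j)
  · intro p _
    exact Prod.ext (Finsupp.ext fun _ => rfl) (Finsupp.ext fun _ => rfl)
  · intro q _
    rfl
  · intro p _
    push_cast
    rfl

/-- A Laguerre polynomial of several variables is a Dirichlet average of products of Laguerre
polynomials of one variable. -/
theorem laguerre_eq_integral {k : ℕ} {α : ℝ} (hα : 0 < α) (n : Fin k → ℕ) (x : Fin k → ℝ)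
    (a : Fin k → ℝ) (ha : ∀ j, 0 < a j) (hsum : ∑ j, a j = 1) :
    ∃ μ : Measure (Fin k → ℝ), IsProbabilityMeasure μ ∧
      (∀ᵐ t ∂μ, (∀ j, 0 ≤ t j) ∧ ∑ j, t j ≤ 1) ∧
      laguerre α n x = pochhammer (α + 1) (∑ j, n j) / (∏ j, pochhammer (a j) (n j)) *
        ∫ t, ∏ j, univLaguerre (a j) (n j) (x j * t j) ∂μ := by
  obtain ⟨μ, hμ, hsupp, hmom⟩ := exists_dirichlet hα k a ha
  refine ⟨μ, hμ, hsupp, ?_⟩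
  -- Because the `a j` sum to `1`, the moments have denominator `pochhammer (α + 1) _`, which is
  -- what lets the factors of the explicit formula match.
  rw [hsum, add_comm] at hmom
  have hint : ∀ m : Fin k → ℕ, Integrable (fun t : Fin k → ℝ => ∏ j, t j ^ m j) μ := by
    intro m
    refine Integrable.of_bound (Measurable.aestronglyMeasurable (by fun_prop)) 1 ?_
    filter_upwards [hsupp] with t ht
    rw [Real.norm_eq_abs, abs_of_nonneg (prod_nonneg fun j _ => pow_nonneg (ht.1 j) _)]
    refine prod_le_one (fun j _ => pow_nonneg (ht.1 j) _) fun j _ => pow_le_one₀ (ht.1 j) ?_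
    exact (single_le_sum (fun i _ => ht.1 i) (mem_univ j)).trans ht.2
  have hexp : ∀ t : Fin k → ℝ, ∏ j, univLaguerre (a j) (n j) (x j * t j) =
      ∑ q ∈ Fintype.piFinset fun j => antidiagonal (n j),
        (∏ j, (-x j) ^ (q j).1 / (q j).1 ! * risingCoeff (a j + (q j).1) (q j).2) *
          ∏ j, t j ^ (q j).1 := by
    intro t
    simp only [univLaguerre]
    rw [prod_univ_sum]
    refine sum_congr rfl fun q _ => ?_
    rw [← prod_mul_distrib]
    refine prod_congr rfl fun j _ => ?_
    rw [← neg_mul, mul_pow]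
    ring
  simp only [hexp]
  rw [integral_finsetSum _ fun q _ => (hint _).const_mul _, mul_sum, laguerre_eq_sum_piFinset]
  refine sum_congr rfl fun q hq => ?_
  have hq' : ∀ j, (q j).1 + (q j).2 = n j := fun j =>
    mem_antidiagonal.1 (Fintype.mem_piFinset.1 hq j)
  rw [integral_const_mul, hmom]
  have hα1 : 0 < α + 1 := by linarith
  have h1 : pochhammer (α + 1) (∑ j, n j) = pochhammer (α + 1) (∑ j, (q j).1) *
      pochhammer (α + 1 + (∑ j, (q j).1 : ℕ)) (∑ j, (q j).2) := by
    rw [← pochhammer_add, ← sum_add_distrib]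
    simp only [hq']
  have h2 : ∏ j, pochhammer (a j) (n j) = (∏ j, pochhammer (a j) (q j).1) *
      ∏ j, pochhammer (a j + (q j).1) (q j).2 := by
    rw [← prod_mul_distrib]
    exact prod_congr rfl fun j _ => by rw [← pochhammer_add, hq']
  have h3 : ∏ j, (-x j) ^ (q j).1 / (q j).1 ! * risingCoeff (a j + (q j).1) (q j).2 =
      (∏ j, (-x j) ^ (q j).1 / ((q j).1 ! * (q j).2 !)) *
        ∏ j, pochhammer (a j + (q j).1) (q j).2 := by
    rw [← prod_mul_distrib]
    refine prod_congr rfl fun j _ => ?_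
    rw [risingCoeff]
    field_simp
  rw [h1, h2, h3]
  have p1 := (pochhammer_pos hα1 (∑ j, (q j).1)).ne'
  have p2 : ∏ j, pochhammer (a j) (q j).1 ≠ 0 :=
    prod_ne_zero_iff.2 fun j _ => (pochhammer_pos (ha j) _).ne'
  have p3 : ∏ j, pochhammer (a j + (q j).1) (q j).2 ≠ 0 :=
    prod_ne_zero_iff.2 fun j _ => (pochhammer_pos (by have := ha j; positivity) _).ne'
  field_simp

theorem exists_const_abs_univLaguerre_le {k : ℕ} (hk : 1 ≤ k) :
    ∃ C : ℝ, 0 ≤ C ∧ C ^ k ≤ 2 ^ (k - 1) ∧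
      ∀ (n : ℕ) (y : ℝ), 0 ≤ y → |univLaguerre (1 / k) n y| ≤ C * Real.exp (y / 2) := by
  obtain rfl | hk2 := hk.eq_or_lt
  · refine ⟨1, zero_le_one, by simp, fun n y hy => ?_⟩
    simpa using abs_univLaguerre_one_le n hy
  · refine ⟨21 / 16, by norm_num, ?_, fun n y hy => ?_⟩
    -- The first two factors cost `441/256 < 2` together, and each further one costs less than `2`.
    · obtain ⟨l, rfl⟩ : ∃ l, k = l + 2 := ⟨k - 2, by lia⟩
      rw [show l + 2 - 1 = l + 1 from rfl, pow_add, pow_add]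
      have h1 : ((21 : ℝ) / 16) ^ l ≤ 2 ^ l := by gcongr; norm_num
      have h2 : ((21 : ℝ) / 16) ^ 2 ≤ 2 ^ 1 := by norm_num
      exact mul_le_mul h1 h2 (by positivity) (by positivity)
    · have hk2' : (2 : ℝ) ≤ k := by exact_mod_cast hk2
      exact abs_univLaguerre_le (by positivity) (one_div_le_one_div_of_le two_pos hk2') n hy

end ErdelyiLaguerre

open ErdelyiLaguerre in
/-- The norm `‖x‖` on `Fin k → ℝ` is the maximum norm. -/
theorem theorem1p1 (k : ℕ) (hk : 1 ≤ k) (α : ℝ) (hα : 0 < α)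
    (x : Fin k → ℝ) (hx : ∀ j, 0 ≤ x j) (n : Fin k → ℕ) :
    |ErdelyiLaguerre.laguerre α n x| ≤
      2 ^ (k - 1) *
        (ErdelyiLaguerre.pochhammer (α + 1) (∑ j, n j) /
          ∏ j, ErdelyiLaguerre.pochhammer (1 / (k : ℝ)) (n j)) *
        Real.exp (‖x‖ / 2) := by
  have hk0 : (0 : ℝ) < k := by exact_mod_cast hk
  obtain ⟨C, hC0, hCk, hC⟩ := exists_const_abs_univLaguerre_le hk
  obtain ⟨μ, hμ, hsupp, hint⟩ := laguerre_eq_integral hα n x (fun _ => 1 / (k : ℝ))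
    (fun _ => by positivity) (by simp [hk0.ne'])
  have hbound : ∀ᵐ t ∂μ, ‖∏ j, univLaguerre (1 / (k : ℝ)) (n j) (x j * t j)‖ ≤
      2 ^ (k - 1) * Real.exp (‖x‖ / 2) := by
    filter_upwards [hsupp] with t ht
    rw [Real.norm_eq_abs, Finset.abs_prod]
    have hxt : ∑ j, x j * t j / 2 ≤ ‖x‖ / 2 := by
      rw [← Finset.sum_div]
      gcongr
      calc ∑ j, x j * t j ≤ ∑ j, ‖x‖ * t j := by
            refine Finset.sum_le_sum fun j _ => mul_le_mul_of_nonneg_right ?_ (ht.1 j)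
            exact (le_abs_self _).trans (norm_le_pi_norm x j)
        _ = ‖x‖ * ∑ j, t j := (Finset.mul_sum _ _ _).symm
        _ ≤ ‖x‖ := mul_le_of_le_one_right (norm_nonneg x) ht.2
    calc _ ≤ ∏ j, C * Real.exp (x j * t j / 2) :=
          Finset.prod_le_prod (fun _ _ => abs_nonneg _) fun j _ =>
            hC _ _ (mul_nonneg (hx j) (ht.1 j))
      _ = C ^ k * Real.exp (∑ j, x j * t j / 2) := by
          rw [Finset.prod_mul_distrib, ← Real.exp_sum]
          simp
      _ ≤ _ := by gcongr
  have hI := MeasureTheory.norm_integral_le_of_norm_le_const hbound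
  rw [MeasureTheory.probReal_univ, mul_one, Real.norm_eq_abs] at hI
  have hq : 0 ≤ pochhammer (α + 1) (∑ j, n j) / ∏ j, pochhammer (1 / (k : ℝ)) (n j) :=
    div_nonneg (pochhammer_pos (by linarith) _).le
      (Finset.prod_nonneg fun j _ => (pochhammer_pos (by positivity) _).le)
  rw [hint, abs_mul, abs_of_nonneg hq]
  calc _ ≤ _ := mul_le_mul_of_nonneg_left hI hq
    _ = _ := by ring
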